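/- Conventions. For a real vector or one-sided real sequence $u$, the variation $\mathrm{var}(u)\in\{0,1,2,\dots\}\cup\{\infty\}$ is the number of sign changes in $u$ after all zeros are deleted, with $\mathrm{var}(0)=0$. A linear map $u\mapsto Xu$ is $\mathrm{OVD}_k$ (order-preserving $k$-variation diminishing) if for every $u$ with $\mathrm{var}(u)\le k$ we have (i) $\mathrm{var}(Xu)\le \mathrm{var}(u)$, and (ii) if $\mathrm{var}(Xu)=\mathrm{var}(u)$ and $u$ and $Xu$ are nonzero, then the first nonzero elements of $u$ and $Xu$ have the same sign. For a real matrix $X$, $X_{[r]}$ denotes its $r$-th multiplicative compound matrix, i.e. the matrix of all $r$-minors of $X$; a matrix $X\in\mathbb{R}^{n\times m}$ is $k$-positive if $k\le\min\{n,m\}$ and $X_{[j]}\ge 0$ entrywise for $1\le j\le k$. For $A\in\mathbb{R}^{n\times n}$ and a row vector $c\in\mathbb{R}^{1\times n}$, let $\mathcal{O}^j(A,c)\in\mathbb{R}^{j\times n}$ be the matrix with rows $c, cA,\dots,cA^{j-1}$, and let $\mathcal{O}(A,c)$ be the observability operator $(\mathcal{O}(A,c)x)(t)=cA^tx$, $x\in\mathbb{R}^n$,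 $t=0,1,2,\dots$. Corollary. Let $k\ge 1$, and let $A\in\mathbb{R}^{n\times n}$, $c\in\mathbb{R}^{1\times n}$ be such that $\mathcal{O}^j(A,c)_{[j]}\ge 0$ for all $1\le j\le k$ and $\operatorname{rank}\mathcal{O}^j(A,c)=j$ for all $1\le j\le k-1$. Assume further that there is an $\varepsilon>0$ such that, for all $\eta\in(0,\varepsilon)$, $A+\eta I$ is $k$-positive and $\operatorname{rank}(A+\eta I)=n$. Then the observability operator $\mathcal{O}(A,c)$ is $\mathrm{OVD}_{k-1}$, and so is the matrix $\mathcal{O}^t(A,c)$ for every $t\ge 0$. -/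

import Mathlib

/-- The variation (number of sign changes) of a real vector (`ι = Fin n`) or one-sided
sequence (`ι = ℕ`): the number, possibly infinite, of pairs of entries that are adjacent after
all zeros have been deleted and whose product is negative. -/
noncomputable def variation {ι : Type*} [LinearOrder ι] (u : ι → ℝ) : ℕ∞ :=
  Set.encard {p : ι × ι | p.1 < p.2 ∧ u p.1 * u p.2 < 0 ∧ ∀ l, p.1 < l → l < p.2 → u l = 0}

/-- `i` is the position of the first nonzero element of `u`. -/
def IsFirstNonzero {ι : Type*} [LinearOrder ι] (u : ι → ℝ) (i : ι) : Prop :=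
  u i ≠ 0 ∧ ∀ l, l < i → u l = 0

/-- Order-preserving `k`-variation diminishing linear maps (`OVD_k`). If `X u = 0`, there is no
first nonzero element of `X u` and the requirement on signs is void. -/
def IsOVD {ι κ : Type*} [LinearOrder ι] [LinearOrder κ] (k : ℕ)
    (X : (ι → ℝ) →ₗ[ℝ] (κ → ℝ)) : Prop :=
  ∀ u : ι → ℝ, variation u ≤ (k : ℕ∞) →
    variation (X u) ≤ variation u ∧
    (variation u = variation (X u) →
      ∀ i j, IsFirstNonzero u i → IsFirstNonzero (X u) j →
        SignType.sign (u i) = SignType.sign (X u j))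

/-- The `r`-th multiplicative compound matrix: all `r`-minors, rows and columns indexed by the
increasing `r`-tuples of indices. -/
noncomputable def compoundMatrix {n m : ℕ} (X : Matrix (Fin n) (Fin m) ℝ) (r : ℕ) :
    Matrix (Fin r ↪o Fin n) (Fin r ↪o Fin m) ℝ :=
  Matrix.of fun I J => (X.submatrix I J).det

/-- Entrywise nonnegativity of a matrix. -/
def EntrywiseNonneg {α β : Type*} (X : Matrix α β ℝ) : Prop :=
  ∀ i j, 0 ≤ X i j

/-- `k`-positive matrices. -/
def IsKPositive {n m : ℕ} (k : ℕ) (X : Matrix (Fin n) (Fin m) ℝ) : Prop :=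
  k ≤ min n m ∧ ∀ j, 1 ≤ j → j ≤ k → EntrywiseNonneg (compoundMatrix X j)

/-- The truncated controllability matrix `(b  Ab  …  A^(j-1) b)`. -/
def controllabilityMatrix {n : ℕ} (A : Matrix (Fin n) (Fin n) ℝ) (b : Fin n → ℝ) (j : ℕ) :
    Matrix (Fin n) (Fin j) ℝ :=
  Matrix.of fun i l => (A ^ (l : ℕ)).mulVec b i

/-- The truncated observability matrix with rows `c, cA, …, cA^(j-1)`. -/
def observabilityMatrix {n : ℕ} (A : Matrix (Fin n) (Fin n) ℝ) (c : Fin n → ℝ) (j : ℕ) :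
    Matrix (Fin j) (Fin n) ℝ :=
  (controllabilityMatrix A.transpose c j).transpose

/-- The observability operator `(𝒪(A,c) x)(t) = c A^t x`, `t = 0, 1, 2, …`. -/
def observabilityOperator {n : ℕ} (A : Matrix (Fin n) (Fin n) ℝ) (c : Fin n → ℝ) :
    (Fin n → ℝ) →ₗ[ℝ] (ℕ → ℝ) where
  toFun x t := c ⬝ᵥ (A ^ t).mulVec x
  map_add' x y := by
    funext t
    simp [Matrix.mulVec_add, dotProduct_add]
  map_smul' a x := by
    funext t
    simp [Matrix.mulVec_smul, dotProduct_smul]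

/-! Everything rests on one fact: all minors of order at most `k` of the infinite matrix with rows
`c A ^ t` are nonnegative.

Given this, `hasAlternation_of_mulVec` pulls an alternation with at most `k` entries in `X u` back
to one in `u` with the same leading sign. Comparing longest alternations then yields both parts of
OVD (`isOVD_of_minorsNonneg`).

For the minors, a block of `r` consecutive rows starting at `i` is `𝒪^r(A,c) A ^ i`, so Cauchy–Binet
settles consecutive rows. Fekete's argument (`fekete`) passes to arbitrary rows, but it divides by
minors of the previous order and so needs them strictly positive. Two perturbations provide
strictness. Replacing `A` by `A + η I` makes it invertible, so that the blocks keep full rank.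
Multiplying on the right by a totally positive Gaussian matrix turns nonnegative minors of a
full-rank block into positive ones. The shift changes `𝒪^r` only by a unit triangular left factor,
so the hypotheses survive it, and the weak inequalities survive both limits. -/

/-! ### Alternations and variation -/

/-- `u` has `q + 1` entries, at increasing positions, whose signs alternate and begin with that
of `σ`. -/
def HasAlternation {ι : Type*} [LinearOrder ι] (σ : ℝ) (q : ℕ) (u : ι → ℝ) : Prop :=
  ∃ e : Fin (q + 1) → ι, StrictMono e ∧ ∀ a : Fin (q + 1), 0 < σ * (-1) ^ (a : ℕ) * u (e a)

section Alternation

variable {ι : Type*} [LinearOrder ι] {σ : ℝ} {q : ℕ} {u : ι → ℝ}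

theorem HasAlternation.tail (h : HasAlternation σ (q + 1) u) : HasAlternation (-σ) q u := by
  obtain ⟨e, he, h⟩ := h
  refine ⟨fun a => e a.succ, he.comp (Fin.strictMono_succ), fun a => ?_⟩
  have := h a.succ
  simpa [pow_succ] using this

theorem HasAlternation.init (h : HasAlternation σ (q + 1) u) : HasAlternation σ q u := by
  obtain ⟨e, he, h⟩ := h
  exact ⟨fun a => e a.castSucc, he.comp (Fin.strictMono_castSucc), fun a => by
    simpa using h a.castSucc⟩

theorem HasAlternation.cons {e : Fin (q + 1) → ι} (he : StrictMono e)
    (h : ∀ a : Fin (q + 1), 0 < -σ * (-1) ^ (a : ℕ) * u (e a)) {i : ι} (hi : i < e 0)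
    (hu : 0 < σ * u i) :
    HasAlternation σ (q + 1) u := by
  refine ⟨Matrix.vecCons i e, he.vecCons hi, fun a => ?_⟩
  refine Fin.cases ?_ (fun a => ?_) a
  · simpa using hu
  · have := h a
    simpa [pow_succ] using this

/-- Whichever alternation starts earlier lends its first entry to the front of the other. -/
theorem HasAlternation.succ_of_neg (h : HasAlternation σ q u) (h' : HasAlternation (-σ) q u) :
    ∃ τ : ℝ, HasAlternation τ (q + 1) u := by
  obtain ⟨e, he, h⟩ := h
  obtain ⟨e', he', h'⟩ := h'
  have h0 : 0 < σ * u (e 0) := by simpa using h 0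
  have h0' : 0 < -σ * u (e' 0) := by simpa using h' 0
  rcases lt_trichotomy (e 0) (e' 0) with hlt | heq | hlt
  · exact ⟨σ, HasAlternation.cons he' h' hlt h0⟩
  · rw [heq] at h0; linarith
  · exact ⟨-σ, HasAlternation.cons he (by simpa using h) hlt h0'⟩

/-- The pairs of positions at which `u` changes sign. -/
def signChanges (u : ι → ℝ) : Set (ι × ι) :=
  {p | p.1 < p.2 ∧ u p.1 * u p.2 < 0 ∧ ∀ l, p.1 < l → l < p.2 → u l = 0}

theorem snd_le_fst_of_signChanges {p p' : ι × ι} (hp : p ∈ signChanges u)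
    (hp' : p' ∈ signChanges u) (h : p.1 < p'.1) : p.2 ≤ p'.1 := by
  by_contra! hlt
  have := hp.2.2 _ h hlt
  have h2 := hp'.2.1
  rw [this] at h2
  simp at h2

theorem eq_of_signChanges_of_fst_eq {p p' : ι × ι} (hp : p ∈ signChanges u)
    (hp' : p' ∈ signChanges u) (h : p.1 = p'.1) : p = p' := by
  have key : ∀ {p p' : ι × ι}, p ∈ signChanges u → p' ∈ signChanges u → p.1 = p'.1 →
      ¬ p.2 < p'.2 := by
    intro p p' hp hp' h hlt
    have := hp'.2.2 p.2 (h ▸ hp.1) hlt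
    have h2 := hp.2.1
    rw [this] at h2
    simp at h2
  exact Prod.ext h (le_antisymm (not_lt.1 (key hp' hp h.symm)) (not_lt.1 (key hp hp' h)))

theorem exists_signChange_between [Fintype ι] {i j : ι} (hij : i < j) (h : u i * u j < 0) :
    ∃ p ∈ signChanges u, i ≤ p.1 ∧ p.2 ≤ j := by
  classical
  -- The change sits between the last position before `j` with the sign of `u i` and the next
  -- nonzero entry.
  set S := Finset.univ.filter fun l => i ≤ l ∧ l < j ∧ 0 < u l * u i
  have hi0 : u i ≠ 0 := by rintro h0; simp [h0] at h
  have hS : S.Nonempty := ⟨i, by simp [S, hij, hi0]⟩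
  set a := S.max' hS
  obtain ⟨ha1, ha2, ha3⟩ : i ≤ a ∧ a < j ∧ 0 < u a * u i := by
    simpa only [S, Finset.mem_filter_univ] using S.max'_mem hS
  set T := Finset.univ.filter fun l => a < l ∧ l ≤ j ∧ u l ≠ 0
  have hj0 : u j ≠ 0 := by rintro h0; simp [h0] at h
  have hT : T.Nonempty := ⟨j, by simp [T, ha2, hj0]⟩
  set b := T.min' hT
  obtain ⟨hb1, hb2, hb3⟩ : a < b ∧ b ≤ j ∧ u b ≠ 0 := by
    simpa only [T, Finset.mem_filter_univ] using T.min'_mem hT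
  have hb : u b * u i < 0 := by
    rcases hb2.eq_or_lt with hb | hb
    · rw [hb]; linarith
    · by_contra! hle
      have hpos : 0 < u b * u i := lt_of_le_of_ne hle (mul_ne_zero hb3 hi0).symm
      have : b ∈ S := by simp [S, hb, hpos, ha1.trans hb1.le]
      exact absurd (S.le_max' b this) (not_le.2 hb1)
  refine ⟨(a, b), ⟨hb1, ?_, fun l hl1 hl2 => ?_⟩, ha1, hb2⟩
  · have := mul_neg_of_pos_of_neg ha3 hb
    have h2 : 0 < u i ^ 2 := by positivity
    by_contra! hle
    dsimp only at hle
    nlinarith [mul_nonneg hle h2.le]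
  · by_contra hne
    have : l ∈ T := by simp [T, hne, hl1, hl2.le.trans hb2]
    exact absurd (T.min'_le l this) (not_le.2 hl2)

theorem HasAlternation.le_variation [Fintype ι] (h : HasAlternation σ q u) :
    (q : ℕ∞) ≤ variation u := by
  obtain ⟨e, he, h⟩ := h
  have key : ∀ a : Fin q, ∃ p ∈ signChanges u, e a.castSucc ≤ p.1 ∧ p.2 ≤ e a.succ := by
    intro a
    refine exists_signChange_between (he (Fin.castSucc_lt_succ)) ?_
    have h1 := h a.castSucc
    have h2 := h a.succ
    have h3 := mul_pos h1 h2
    have h4 : σ * (-1) ^ (a.castSucc : ℕ) * u (e a.castSucc) *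
        (σ * (-1) ^ (a.succ : ℕ) * u (e a.succ)) =
        -(σ ^ 2 * (u (e a.castSucc) * u (e a.succ))) := by
      have : ((-1 : ℝ) ^ (a : ℕ)) * (-1) ^ (a : ℕ) = 1 := by
        rw [← mul_pow]; simp
      simp only [Fin.val_castSucc, Fin.val_succ, pow_succ]
      linear_combination (-(σ ^ 2 * (u (e a.castSucc) * u (e a.succ)))) * this
    rw [h4] at h3
    by_contra! hle
    have := mul_nonneg (sq_nonneg σ) hle
    linarith
  choose p hp hp1 hp2 using key
  have hlt : ∀ a b : Fin q, a < b → (p a).1 < (p b).1 := fun a b hab =>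
    ((hp a).1.trans_le (hp2 a)).trans_le ((he.monotone (by
      rw [Fin.le_def]; simp only [Fin.val_succ, Fin.val_castSucc]; exact hab)).trans (hp1 b))
  have hinj : Function.Injective p := by
    intro a b hab
    rcases lt_trichotomy a b with h | h | h
    · exact absurd (hlt a b h) (by rw [hab]; exact lt_irrefl _)
    · exact h
    · exact absurd (hlt b a h) (by rw [hab]; exact lt_irrefl _)
  calc (q : ℕ∞) = Set.encard (Set.range p) := by
        rw [← Set.image_univ, hinj.encard_image, Set.encard_univ]; simp
    _ ≤ variation u := Set.encard_le_encard (by rintro _ ⟨a, rfl⟩; exact hp a)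

/-- Finite sets of sign changes suffice even when the variation is infinite. Sign changes are added
by increasing first position; the final clause keeps the alternation to the left of the next one,
where one of `p.1`, `p.2` has the sign needed to extend it. -/
theorem exists_alternation_of_finset {j : ι} (hj : IsFirstNonzero u j)
    (hσ : 0 < σ * u j) (F : Finset (ι × ι)) (hF : ∀ p ∈ F, p ∈ signChanges u) :
    ∃ e : Fin (F.card + 1) → ι, StrictMono e ∧
      (∀ a : Fin (F.card + 1), 0 < σ * (-1) ^ (a : ℕ) * u (e a)) ∧
      ∀ i, j ≤ i → (∀ p ∈ F, p.2 ≤ i) → e (Fin.last _) ≤ i := by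
  classical
  induction F using Finset.induction_on_max_value (fun p : ι × ι => p.1) with
  | empty =>
    refine ⟨fun _ => j, fun a b hab => ?_, fun a => ?_, fun i hi _ => hi⟩
    · exact absurd hab (by have := a.2; have := b.2; simp at *; omega)
    · have : (a : ℕ) = 0 := by have := a.2; simp at this; omega
      simpa [this] using hσ
  | insert p F hp hmax ih =>
    obtain ⟨e, he, hsgn, hlast⟩ := ih fun p' hp' => hF p' (Finset.mem_insert_of_mem hp')
    have hpS := hF p (Finset.mem_insert_self _ _)
    have hle : e (Fin.last _) ≤ p.1 := by
      refine hlast _ ?_ fun p' hp' => ?_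
      · by_contra! hlt
        have h2 := hpS.2.1
        rw [hj.2 _ hlt] at h2
        simp at h2
      · have hp'S := hF p' (Finset.mem_insert_of_mem hp')
        refine snd_le_fst_of_signChanges hp'S hpS (lt_of_le_of_ne (hmax p' hp') fun heq => ?_)
        exact hp (eq_of_signChanges_of_fst_eq hp'S hpS heq ▸ hp')
    have hnext : ∃ i, e (Fin.last _) < i ∧ i ≤ p.2 ∧ 0 < σ * (-1) ^ (F.card + 1) * u i := by
      have hl := hsgn (Fin.last _)
      rw [Fin.val_last] at hl
      have hneg := hpS.2.1
      set s := σ * (-1) ^ F.card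
      have hs : s ≠ 0 := by rintro h0; simp [h0] at hl
      have h12 : (s * u p.1) * (s * u p.2) < 0 := by
        have : (s * u p.1) * (s * u p.2) = s ^ 2 * (u p.1 * u p.2) := by ring
        rw [this]
        exact mul_neg_of_pos_of_neg (by positivity) hneg
      have hs' : σ * (-1) ^ (F.card + 1) = -s := by simp [s, pow_succ]
      rw [hs']
      rcases lt_or_ge (s * u p.1) 0 with h1 | h1
      · refine ⟨p.1, lt_of_le_of_ne hle fun heq => ?_, hpS.1.le, by linarith⟩
        rw [heq] at hl; linarith
      · refine ⟨p.2, hle.trans_lt hpS.1, le_rfl, ?_⟩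
        by_contra! h2
        nlinarith [mul_nonneg h1 (by linarith : 0 ≤ s * u p.2)]
    obtain ⟨i, hi1, hi2, hi3⟩ := hnext
    rw [Finset.card_insert_of_notMem hp]
    refine ⟨Fin.snoc e i, ?_, fun a => ?_, fun l _ hl => ?_⟩
    · rw [Fin.strictMono_iff_lt_succ]
      intro a
      refine Fin.lastCases ?_ (fun a => ?_) a
      · rw [Fin.succ_last, Fin.snoc_last, Fin.snoc_castSucc]; exact hi1
      · rw [Fin.succ_castSucc, Fin.snoc_castSucc, Fin.snoc_castSucc]
        exact he (Fin.castSucc_lt_succ)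
    · refine Fin.lastCases ?_ (fun a => ?_) a
      · rw [Fin.snoc_last]; exact hi3
      · rw [Fin.snoc_castSucc]; exact hsgn a
    · rw [Fin.snoc_last]
      exact hi2.trans (hl p (Finset.mem_insert_self _ _))

theorem hasAlternation_of_le_variation {j : ι} (hj : IsFirstNonzero u j) (hσ : 0 < σ * u j)
    (hq : (q : ℕ∞) ≤ variation u) : HasAlternation σ q u := by
  obtain ⟨t, ht, htq⟩ := Set.exists_subset_encard_eq hq
  have hfin : t.Finite := Set.finite_of_encard_eq_coe htq
  have hc : hfin.toFinset.card = q := by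
    rw [hfin.encard_eq_coe_toFinset_card] at htq
    exact_mod_cast htq
  obtain ⟨e, he, h, -⟩ := exists_alternation_of_finset hj hσ hfin.toFinset
    fun p hp => ht (by simpa using hp)
  subst hc
  exact ⟨e, he, h⟩

theorem exists_isFirstNonzero [WellFoundedLT ι] (h : 0 < variation u) :
    ∃ j, IsFirstNonzero u j := by
  obtain ⟨p, hp⟩ := Set.encard_pos.1 h
  have hne : {i | u i ≠ 0}.Nonempty := ⟨p.1, fun h0 => by
    have := hp.2.1
    rw [h0] at this
    simp at this⟩
  have hwf : WellFounded (fun a b : ι => a < b) := wellFounded_lt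
  refine ⟨hwf.min _ hne, hwf.min_mem _ hne, fun l hl => ?_⟩
  by_contra hl0
  exact hwf.not_lt_min _ hl0 hl

end Alternation

/-! ### Variation diminution from nonnegative minors -/

open Matrix in
/-- A Carathéodory-type reduction: a vector can be replaced by a sign-compatible one with the
same image whose support selects linearly independent columns. -/
theorem exists_signCompatible_linearIndependent {m n : Type*} [Fintype n]
    (X : Matrix m n ℝ) (u : n → ℝ) :
    ∃ v : n → ℝ, X *ᵥ v = X *ᵥ u ∧ (∀ j, v j ≠ 0 → 0 < v j * u j) ∧
      ∀ w : n → ℝ, (∀ j, v j = 0 → w j = 0) → X *ᵥ w = 0 → w = 0 := by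
  classical
  induction hN : (Finset.univ.filter fun j => u j ≠ 0).card using Nat.strong_induction_on
    generalizing u with
  | _ N ih =>
    by_cases hind : ∀ w : n → ℝ, (∀ j, u j = 0 → w j = 0) → X *ᵥ w = 0 → w = 0
    · exact ⟨u, rfl, fun j hj => mul_self_pos.2 hj, hind⟩
    push Not at hind
    obtain ⟨w, hw, hXw, hw0⟩ := hind
    obtain ⟨j₁, hj₁⟩ := Function.ne_iff.1 hw0
    obtain ⟨j₀, hj₀, hmin⟩ := Finset.exists_min_image (Finset.univ.filter fun j => w j ≠ 0)
      (fun j => |u j / w j|) ⟨j₁, by simpa using hj₁⟩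
    have hwj₀ : w j₀ ≠ 0 := by simpa using hj₀
    have huj₀ : u j₀ ≠ 0 := fun h => hwj₀ (hw _ h)
    -- The ratio of least modulus: moving along `w` by `t` kills the entry `j₀` before any other
    -- entry can change sign.
    set t := -(u j₀ / w j₀)
    have hcompat : ∀ j, 0 ≤ (u j + t * w j) * u j := by
      intro j
      by_cases hwj : w j = 0
      · simpa [hwj] using mul_self_nonneg (u j)
      have hm : |t| ≤ |u j / w j| := by
        simpa [t] using hmin j (by simpa using hwj)
      have h1 : |t * w j| ≤ |u j| := by
        rw [abs_mul]
        rwa [abs_div, le_div_iff₀ (abs_pos.2 hwj)] at hm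
      have h2 : |t * w j * u j| ≤ u j * u j := by
        rw [abs_mul, ← abs_mul_abs_self (u j)]
        exact mul_le_mul_of_nonneg_right h1 (abs_nonneg _)
      have := neg_abs_le (t * w j * u j)
      nlinarith
    have hsub : ∀ j, u j + t * w j ≠ 0 → u j ≠ 0 := fun j hj h => hj (by simp [h, hw j h])
    obtain ⟨v, hv1, hv2, hv3⟩ := ih _ (by
      rw [← hN]
      refine Finset.card_lt_card (Finset.ssubset_iff_of_subset ?_ |>.2 ⟨j₀, ?_, ?_⟩)
      · intro j hj
        simp only [Finset.mem_filter_univ] at hj ⊢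
        exact hsub j hj
      · simpa using huj₀
      · simp [t, hwj₀]) (fun j => u j + t * w j) rfl
    refine ⟨v, ?_, fun j hj => ?_, hv3⟩
    · rw [hv1]
      have : (fun j => u j + t * w j) = u + t • w := rfl
      rw [this, Matrix.mulVec_add, Matrix.mulVec_smul, hXw, smul_zero, add_zero]
    · have h1 := hv2 j hj
      have h2 : u j + t * w j ≠ 0 := by rintro h; simp [h] at h1
      have h3 := lt_of_le_of_ne (hcompat j) (mul_ne_zero h2 (hsub j h2)).symm
      have h4 := mul_pos h1 h3
      have h5 : v j * (u j + t * w j) * ((u j + t * w j) * u j) =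
          (u j + t * w j) ^ 2 * (v j * u j) := by ring
      rw [h5] at h4
      exact pos_of_mul_pos_right h4 (sq_nonneg _)

theorem HasAlternation.of_signCompatible {ι : Type*} [LinearOrder ι] {σ : ℝ} {q : ℕ}
    {u v : ι → ℝ} (h : HasAlternation σ q v) (hc : ∀ j, v j ≠ 0 → 0 < v j * u j) :
    HasAlternation σ q u := by
  obtain ⟨e, he, h⟩ := h
  refine ⟨e, he, fun a => ?_⟩
  have h1 := h a
  have h2 := hc (e a) (by rintro h0; simp [h0] at h1)
  have h3 := mul_pos h1 h2
  have h4 : σ * (-1) ^ (a : ℕ) * v (e a) * (v (e a) * u (e a)) =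
    v (e a) ^ 2 * (σ * (-1) ^ (a : ℕ) * u (e a)) := by ring
  rw [h4] at h3
  exact pos_of_mul_pos_right h3 (sq_nonneg _)

/-- Nonnegativity of all minors of order `r`. -/
def MinorsNonneg {κ ι : Type*} [LinearOrder κ] [LinearOrder ι] (X : Matrix κ ι ℝ) (r : ℕ) :
    Prop :=
  ∀ (I : Fin r ↪o κ) (J : Fin r ↪o ι), 0 ≤ (X.submatrix I J).det

open Matrix in
-- In Cramer's rule the cofactor signs cancel the alternating signs of `M *ᵥ x`, leaving a sum of
-- nonnegative terms. The minors may vanish, so strictness comes from `x a ≠ 0`.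
theorem hasAlternation_of_det_pos {q : ℕ} {σ : ℝ} (M : Matrix (Fin (q + 1)) (Fin (q + 1)) ℝ)
    (hdet : 0 < M.det) (hM : MinorsNonneg M q) (x : Fin (q + 1) → ℝ) (hx : ∀ a, x a ≠ 0)
    (h : ∀ a : Fin (q + 1), 0 < σ * (-1) ^ (a : ℕ) * (M *ᵥ x) a) (a : Fin (q + 1)) :
    0 < σ * (-1) ^ (a : ℕ) * x a := by
  have hσ : σ ≠ 0 := by rintro rfl; simpa using h 0
  have hcr : M.det * x a = ∑ b, M.adjugate a b * (M *ᵥ x) b := by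
    have : M.adjugate *ᵥ (M *ᵥ x) = M.det • x := by
      rw [Matrix.mulVec_mulVec, Matrix.adjugate_mul, Matrix.smul_mulVec, Matrix.one_mulVec]
    have := congrFun this a
    simpa [Matrix.mulVec, dotProduct] using this.symm
  have hnn : 0 ≤ M.det * (σ * (-1) ^ (a : ℕ) * x a) := by
    have : M.det * (σ * (-1) ^ (a : ℕ) * x a) =
        ∑ b : Fin (q + 1), (M.submatrix b.succAbove a.succAbove).det *
          (σ * (-1) ^ (b : ℕ) * (M *ᵥ x) b) := by
      rw [mul_left_comm, hcr, Finset.mul_sum]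
      refine Finset.sum_congr rfl fun b _ => ?_
      rw [Matrix.adjugate_fin_succ_eq_det_submatrix, pow_add]
      have : ((-1 : ℝ) ^ (a : ℕ)) * (-1) ^ (a : ℕ) = 1 := by rw [← mul_pow]; simp
      linear_combination (σ * (-1) ^ (b : ℕ) *
        (M.submatrix b.succAbove a.succAbove).det * (M *ᵥ x) b) * this
    rw [this]
    exact Finset.sum_nonneg fun b _ =>
      mul_nonneg (hM (Fin.succAboveOrderEmb b) (Fin.succAboveOrderEmb a)) (h b).le
  refine lt_of_le_of_ne (nonneg_of_mul_nonneg_right hnn hdet) ?_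
  exact (mul_ne_zero (mul_ne_zero hσ (pow_ne_zero _ (by norm_num))) (hx a)).symm

open Matrix in
theorem mulVec_extend {m n s : Type*} [Fintype n] [Fintype s] (Y : Matrix m n ℝ) {J : s → n}
    (hJ : Function.Injective J) (x : s → ℝ) :
    Y *ᵥ Function.extend J x 0 = Y.submatrix id J *ᵥ x := by
  funext i
  refine (Fintype.sum_of_injective J hJ _ _ (fun j hj => ?_) fun a => ?_).symm
  · rw [Function.extend_apply' _ _ _ (by simpa using hj)]; simp
  · rw [hJ.extend_apply]; rfl

theorem MinorsNonneg.submatrix {κ ι κ' ι' : Type*} [LinearOrder κ] [LinearOrder ι]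
    [LinearOrder κ'] [LinearOrder ι'] {X : Matrix κ ι ℝ} {r : ℕ} (hX : MinorsNonneg X r)
    {e : κ' → κ} (he : StrictMono e) {f : ι' → ι} (hf : StrictMono f) :
    MinorsNonneg (X.submatrix e f) r := fun I J =>
  hX (I.trans (OrderEmbedding.ofStrictMono e he)) (J.trans (OrderEmbedding.ofStrictMono f hf))

open Matrix in
theorem hasAlternation_of_mulVec {κ : Type} [LinearOrder κ] {n : ℕ} (X : Matrix κ (Fin n) ℝ)
    (q : ℕ) (hX : ∀ r ≤ q + 1, MinorsNonneg X r) (σ : ℝ) (u : Fin n → ℝ)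
    (h : HasAlternation σ q (X *ᵥ u)) : HasAlternation σ q u := by
  classical
  induction q using Nat.strong_induction_on generalizing κ σ u with
  | _ q ih =>
  obtain ⟨e, he, h⟩ := h
  set Y := X.submatrix e id with hY
  obtain ⟨v, hv1, hv2, hv3⟩ := exists_signCompatible_linearIndependent Y u
  refine HasAlternation.of_signCompatible (v := v) ?_ hv2
  have hYv : ∀ a : Fin (q + 1), 0 < σ * (-1) ^ (a : ℕ) * (Y *ᵥ v) a := by
    intro a; rw [hv1]; exact h a
  have hYm : ∀ r ≤ q + 1, MinorsNonneg Y r := fun r hr => (hX r hr).submatrix he strictMono_id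
  obtain ⟨s, J, hJ⟩ : ∃ (s : ℕ) (J : Fin s ↪o Fin n), Set.range J = {j | v j ≠ 0} :=
    ⟨_, (Finset.univ.filter fun j => v j ≠ 0).orderEmbOfFin rfl, by simp⟩
  have hvJ : v = Function.extend J (v ∘ J) 0 := by
    funext j
    by_cases hj : j ∈ Set.range J
    · obtain ⟨a, rfl⟩ := hj
      rw [J.injective.extend_apply]; rfl
    · rw [Function.extend_apply' _ _ _ hj]
      rw [hJ] at hj
      simpa using hj
  have hker : ∀ x : Fin s → ℝ, Y.submatrix id J *ᵥ x = 0 → x = 0 := by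
    intro x hx
    rw [← mulVec_extend Y J.injective] at hx
    have := hv3 _ (fun j hj => ?_) hx
    · funext a
      rw [← J.injective.extend_apply x 0 a, this]; rfl
    · refine Function.extend_apply' _ _ _ fun hj' => ?_
      have : j ∈ Set.range J := hj'
      rw [hJ] at this
      exact this hj
  have hsq : s ≤ q + 1 := by
    have := LinearMap.finrank_le_finrank_of_injective
      (f := (Y.submatrix id J).mulVecLin)
      ((injective_iff_map_eq_zero _).2 fun x hx => hker x hx)
    simpa using this
  rcases hsq.eq_or_lt with rfl | hlt
  -- With full support the selected columns form an invertible square matrix, and Cramer's rule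
  -- applies.
  · have hMdet : 0 < (Y.submatrix id J).det := by
      refine lt_of_le_of_ne (hYm (q + 1) le_rfl (RelEmbedding.refl _) J) fun h0 => ?_
      obtain ⟨x, hx0, hx⟩ := Matrix.exists_mulVec_eq_zero_iff.2 h0.symm
      exact hx0 (hker x hx)
    refine ⟨J, J.strictMono, hasAlternation_of_det_pos _ hMdet
      ((hYm q (Nat.le_succ q)).submatrix strictMono_id J.strictMono) (v ∘ J) (fun a => ?_) ?_⟩
    · have : J a ∈ Set.range J := ⟨a, rfl⟩
      rw [hJ] at this
      exact this
    · rw [← mulVec_extend Y J.injective, ← hvJ]; exact hYv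
  -- Here `v` has at most `q` nonzero entries, too few for `q + 1` alternating ones. Yet the
  -- induction hypothesis, applied to the image without its last and without its first entry,
  -- produces such an alternation.
  · exfalso
    have hcard : ¬ ∃ τ : ℝ, HasAlternation τ q v := by
      rintro ⟨τ, f, hf, hpos⟩
      have hmem : ∀ a, f a ∈ Set.range J := fun a => by
        rw [hJ]; intro h0
        have := hpos a
        rw [h0] at this
        simp at this
      choose g hg using hmem
      have hgi : Function.Injective g := fun a b hab => hf.injective (by rw [← hg a, hab, hg b])
      have := Fintype.card_le_of_injective g hgi
      simp at this
      omega
    refine hcard ?_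
    have halt : HasAlternation σ q (Y *ᵥ v) := ⟨id, strictMono_id, hYv⟩
    cases q with
    | zero =>
      have hs : s = 0 := by omega
      subst hs
      have hv0 : v = 0 := by
        rw [hvJ]; funext j
        exact Function.extend_apply' _ _ _ fun ⟨a, _⟩ => a.elim0
      obtain ⟨f, -, hf⟩ := halt
      have := hf 0
      simp [hv0] at this
    | succ q =>
      have hY' : ∀ r ≤ q + 1, MinorsNonneg Y r := fun r hr => hYm r (by omega)
      exact HasAlternation.succ_of_neg (ih q (Nat.lt_succ_self q) Y hY' σ v halt.init)
        (ih q (Nat.lt_succ_self q) Y hY' (-σ) v halt.tail)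

open Matrix in
theorem isOVD_of_minorsNonneg {κ : Type} [LinearOrder κ] [WellFoundedLT κ] {n : ℕ} (k : ℕ)
    (X : Matrix κ (Fin n) ℝ) (hX : ∀ r ≤ k + 1, MinorsNonneg X r)
    (T : (Fin n → ℝ) →ₗ[ℝ] (κ → ℝ)) (hT : ∀ u, T u = X *ᵥ u) : IsOVD k T := by
  intro u hu
  rw [hT]
  obtain ⟨v, hv⟩ := ENat.ne_top_iff_exists.1 (ne_top_of_le_ne_top (ENat.natCast_ne_top k) hu)
  have hvk : v ≤ k := by rw [← hv] at hu; exact_mod_cast hu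
  have hXv : ∀ r ≤ v + 1, MinorsNonneg X r := fun r hr => hX r (by omega)
  have hnot : ∀ τ : ℝ, ¬ HasAlternation τ (v + 1) u := fun τ h => by
    have := h.le_variation
    rw [← hv] at this
    have : v + 1 ≤ v := by exact_mod_cast this
    omega
  refine ⟨?_, fun heq i j hi hj => ?_⟩
  · by_contra! hlt
    obtain ⟨j, hj⟩ := exists_isFirstNonzero (pos_of_gt hlt)
    have hle : ((v + 1 : ℕ) : ℕ∞) ≤ variation (X *ᵥ u) := by
      rw [← hv] at hlt
      push_cast
      exact Order.add_one_le_of_lt hlt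
    have halt := hasAlternation_of_le_variation hj (mul_self_pos.2 hj.1) hle
    -- A direct pullback would need minors of order `v + 2`. The two shorter alternations need only
    -- order `v + 1`, and their opposite leading signs let them combine.
    obtain ⟨τ, hτ⟩ := HasAlternation.succ_of_neg (hasAlternation_of_mulVec X v hXv _ u halt.init)
      (hasAlternation_of_mulVec X v hXv _ u halt.tail)
    exact hnot τ hτ
  · have halt := hasAlternation_of_mulVec X v hXv _ u
      (hasAlternation_of_le_variation hj (mul_self_pos.2 hj.1) (by rw [← heq, hv]))
    obtain ⟨e, he, hpos⟩ := halt
    -- Otherwise the first nonzero entry of `u` could be prepended to the pulled-back alternation,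
    -- exceeding the variation of `u`.
    have hij : 0 < (X *ᵥ u) j * u i := by
      by_contra! hle
      have hneg : 0 < -(X *ᵥ u) j * u i := by
        have := lt_of_le_of_ne hle (mul_ne_zero hj.1 hi.1)
        linarith
      have h0 : 0 < (X *ᵥ u) j * u (e 0) := by simpa using hpos 0
      have hie : i < e 0 := by
        rcases lt_trichotomy i (e 0) with hlt | heq | hlt
        · exact hlt
        · rw [← heq] at h0; linarith
        · rw [hi.2 _ hlt] at h0; simp at h0
      exact hnot _ (HasAlternation.cons he (by simpa using hpos) hie hneg)
    rcases pos_and_pos_or_neg_and_neg_of_mul_pos hij with ⟨h1, h2⟩ | ⟨h1, h2⟩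
    · rw [sign_pos h1, sign_pos h2]
    · rw [sign_neg h1, sign_neg h2]

/-! ### Determinantal identities -/

open Matrix in
/-- The Cauchy–Binet formula. -/
theorem det_mul_eq_sum_minors {r n : ℕ} [Fintype (Fin r ↪o Fin n)]
    (A : Matrix (Fin r) (Fin n) ℝ) (B : Matrix (Fin n) (Fin r) ℝ) :
    (A * B).det = ∑ J : Fin r ↪o Fin n, (A.submatrix id J).det * (B.submatrix J id).det := by
  classical
  have h1 : (A * B).det = ∑ f : Fin r → Fin n, (∏ i, A i (f i)) * (B.submatrix f id).det := by
    have hrow : A * B = fun i => ∑ l, A i l • B l := by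
      ext i j
      simp [Matrix.mul_apply]
    have := (Matrix.detRowAlternating (R := ℝ) (n := Fin r)).toMultilinearMap.map_sum
      (fun i l => A i l • B l)
    rw [hrow]
    refine this.trans (Finset.sum_congr rfl fun f _ => ?_)
    rw [MultilinearMap.map_smul_univ]
    rfl
  have h2 : ∀ J : Fin r ↪o Fin n, (A.submatrix id J).det * (B.submatrix J id).det =
      ∑ τ : Equiv.Perm (Fin r), (∏ i, A i (J (τ i))) * (B.submatrix (J ∘ τ) id).det := by
    intro J
    rw [← Matrix.det_transpose, Matrix.det_apply', Finset.sum_mul]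
    refine Finset.sum_congr rfl fun τ _ => ?_
    have : B.submatrix (J ∘ τ) id = (B.submatrix J id).submatrix τ id := rfl
    rw [this, Matrix.det_permute]
    simp only [Matrix.transpose_apply, Matrix.submatrix_apply, id]
    ring
  rw [h1, Finset.sum_congr rfl fun J _ => h2 J, ← Fintype.sum_prod_type'
    (f := fun (J : Fin r ↪o Fin n) (τ : Equiv.Perm (Fin r)) =>
      (∏ i, A i (J (τ i))) * (B.submatrix (J ∘ τ) id).det)]
  symm
  -- An injective `f` factors uniquely as a permutation followed by an increasing map; for any other
  -- `f` the minor of `B` has two equal rows.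
  refine Finset.sum_of_injOn (fun p => p.1 ∘ p.2) ?_ (fun _ _ => by simp) ?_ fun p _ => rfl
  · rintro ⟨J, τ⟩ - ⟨J', τ'⟩ - h
    have h : (J ∘ τ : Fin r → Fin n) = J' ∘ τ' := h
    have hJ : J = J' := by
      have hr : Set.range J = Set.range J' := by
        rw [← τ.surjective.range_comp, h, τ'.surjective.range_comp]
      exact DFunLike.coe_injective ((J.strictMono.range_inj J'.strictMono).1 hr)
    subst hJ
    have hτ : τ = τ' := Equiv.ext fun i => J.injective (congrFun h i)
    rw [hτ]
  · intro f _ hf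
    by_cases hinj : Function.Injective f
    · refine absurd ?_ hf
      have hc : (Finset.univ.image f).card = r := by
        rw [Finset.card_image_of_injective _ hinj]; simp
      set J := (Finset.univ.image f).orderEmbOfFin hc
      have hmem : ∀ i, ∃ a, J a = f i := fun i => by
        have : f i ∈ Set.range J := by simp [J]
        exact this
      choose g hg using hmem
      have hgi : Function.Injective g := fun a b hab => hinj (by rw [← hg a, hab, hg b])
      refine ⟨(J, Equiv.ofBijective g (Finite.injective_iff_bijective.1 hgi)), by simp, ?_⟩
      funext i
      exact hg i
    · obtain ⟨i, j, hij, hne⟩ : ∃ i j, f i = f j ∧ i ≠ j := by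
        simpa [Function.Injective] using hinj
      rw [Matrix.det_zero_of_row_eq hne (by funext l; simp [hij]), mul_zero]

/-- Deleting one interior row `p`, or an end row, from an `(r + 2) × (r + 1)` matrix: a three-term
relation between the resulting minors and those with one more row and one column deleted. -/
theorem three_term_minors {r : ℕ} (M : Matrix (Fin (r + 3)) (Fin (r + 2)) ℝ) (p : Fin (r + 1)) :
    (M.submatrix p.castSucc.succ.succAbove id).det *
        (M.submatrix (fun i : Fin (r + 1) => i.castSucc.succ) Fin.succ).det =
      (M.submatrix (Fin.succAbove 0) id).det *
        (M.submatrix (fun i : Fin (r + 1) => (p.succ.succAbove i).castSucc) Fin.succ).det +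
      (M.submatrix (Fin.last _).succAbove id).det *
        (M.submatrix (fun i : Fin (r + 1) => (p.castSucc.succAbove i).succ) Fin.succ).det := by
  -- Expansion along the first column of `M` bordered by a copy of its own column `l`.
  have hrel : ∀ l, ∑ i : Fin (r + 3), (-1) ^ (i : ℕ) * M i l *
      (M.submatrix i.succAbove id).det = 0 := by
    intro l
    have h0 : (Matrix.of fun i : Fin (r + 3) => (Fin.cons (M i l) (M i) : Fin (r + 3) → ℝ)).det
        = 0 := Matrix.det_zero_of_column_eq (i := 0) (j := l.succ) (Fin.succ_ne_zero l).symm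
          fun i => by simp
    rw [Matrix.det_succ_column_zero] at h0
    exact h0
  set N : Matrix (Fin (r + 1)) (Fin (r + 1)) ℝ :=
    M.submatrix (fun i : Fin (r + 1) => i.castSucc.succ) Fin.succ with hN
  set f : (Fin (r + 1) → ℝ) → ℝ := fun v => (N.updateRow p v).det with hf
  have hfrow : ∀ v, f v = ∑ l : Fin (r + 1), (-1) ^ ((p : ℕ) + (l : ℕ)) * v l *
      (N.submatrix p.succAbove l.succAbove).det := by
    intro v
    rw [hf]
    dsimp only
    rw [Matrix.det_succ_row _ p]
    refine Finset.sum_congr rfl fun l _ => ?_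
    rw [Matrix.updateRow_self, Matrix.submatrix_updateRow_succAbove]
  -- A linear functional of the relations among the rows: `f` vanishes on the interior rows other
  -- than `p`, so three terms remain.
  have hsum : ∑ i : Fin (r + 3), (-1) ^ (i : ℕ) * (M.submatrix i.succAbove id).det *
      f (fun l => M i l.succ) = 0 := by
    simp only [hfrow, Finset.mul_sum]
    rw [Finset.sum_comm]
    refine Finset.sum_eq_zero fun l _ => ?_
    have := congrArg (fun x => (-1) ^ ((p : ℕ) + (l : ℕ)) *
      (N.submatrix p.succAbove l.succAbove).det * x) (hrel l.succ)
    simp only [Finset.mul_sum, mul_zero] at this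
    rw [← this]
    exact Finset.sum_congr rfl fun i _ => by ring
  have hfp : f (fun l => M p.castSucc.succ l.succ) = N.det := by
    rw [hf]
    dsimp only
    congr 1
    exact Matrix.updateRow_eq_self N p
  have hfne : ∀ j : Fin (r + 1), j ≠ p → f (fun l => M j.castSucc.succ l.succ) = 0 := by
    intro j hj
    refine Matrix.det_zero_of_row_eq hj ?_
    rw [Matrix.updateRow_self, Matrix.updateRow_ne hj]
    rfl
  have hf0 : f (fun l => M 0 l.succ) = (-1) ^ (p : ℕ) *
      (M.submatrix (fun i : Fin (r + 1) => (p.succ.succAbove i).castSucc) Fin.succ).det := by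
    rw [hfrow, Matrix.det_succ_row_zero, Finset.mul_sum]
    refine Finset.sum_congr rfl fun l _ => ?_
    have hs :
        (M.submatrix (fun i : Fin (r + 1) => (p.succ.succAbove i).castSucc) Fin.succ).submatrix
          Fin.succ l.succAbove = N.submatrix p.succAbove l.succAbove := by
      ext i j
      simp [hN]
    rw [hs, pow_add]
    simp
    ring
  have hfl : f (fun l => M (Fin.last _) l.succ) = (-1) ^ ((p : ℕ) + r) *
      (M.submatrix (fun i : Fin (r + 1) => (p.castSucc.succAbove i).succ) Fin.succ).det := by
    rw [hfrow, Matrix.det_succ_row _ (Fin.last r), Finset.mul_sum]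
    refine Finset.sum_congr rfl fun l _ => ?_
    have hs :
        (M.submatrix (fun i : Fin (r + 1) => (p.castSucc.succAbove i).succ) Fin.succ).submatrix
        (Fin.last r).succAbove l.succAbove = N.submatrix p.succAbove l.succAbove := by
      ext i j
      simp [hN, Fin.succAbove_last, ← Fin.castSucc_succAbove_castSucc]
    have hr : ((-1 : ℝ) ^ r) * (-1) ^ r = 1 := by rw [← mul_pow]; simp
    have hlast : p.castSucc.succAbove (Fin.last r) = Fin.last (r + 1) := by
      simp
    rw [hs, Matrix.submatrix_apply, hlast, Fin.succ_last, Fin.val_last, pow_add, pow_add, pow_add]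
    linear_combination (-(-1) ^ (p : ℕ) * (-1) ^ (l : ℕ) * M (Fin.last _) l.succ *
      (N.submatrix p.succAbove l.succAbove).det) * hr
  rw [Fin.sum_univ_succ, Fin.sum_univ_castSucc, Finset.sum_eq_single p
    (fun j _ hj => by rw [hfne j hj, mul_zero]) (by simp), hfp, Fin.succ_last, hf0, hfl] at hsum
  have hpp : ((-1 : ℝ) ^ (p : ℕ)) * (-1) ^ (p : ℕ) = 1 := by rw [← mul_pow]; simp
  have hr : ((-1 : ℝ) ^ r) * (-1) ^ r = 1 := by rw [← mul_pow]; simp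
  simp only [Fin.val_zero, pow_zero, Fin.val_succ, Fin.val_castSucc, Fin.val_last, pow_succ,
    pow_add] at hsum
  generalize (M.submatrix p.castSucc.succ.succAbove id).det = Dp at *
  generalize (M.submatrix (Fin.succAbove 0) id).det = D0 at *
  generalize (M.submatrix (Fin.last (r + 2)).succAbove id).det = Dl at *
  generalize (M.submatrix (fun i : Fin (r + 1) => (p.succ.succAbove i).castSucc) Fin.succ).det
    = E0 at *
  generalize (M.submatrix (fun i : Fin (r + 1) => (p.castSucc.succAbove i).succ) Fin.succ).det
    = El at *
  linear_combination (-(-1) ^ (p : ℕ)) * hsum + (D0 * E0 - Dp * N.det + Dl * El) * hpp +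
    (Dl * El * (-1) ^ (p : ℕ) * (-1) ^ (p : ℕ)) * hr

/-! ### Fekete's criterion and Gaussian total positivity -/

/-- Positivity of all minors of order `r`. -/
def MinorsPos {κ ι : Type*} [LinearOrder κ] [LinearOrder ι] (X : Matrix κ ι ℝ) (r : ℕ) : Prop :=
  ∀ (I : Fin r ↪o κ) (J : Fin r ↪o ι), 0 < (X.submatrix I J).det

theorem MinorsPos.of_strictMono {κ ι : Type*} [LinearOrder κ] [LinearOrder ι] {X : Matrix κ ι ℝ}
    {r : ℕ} (hX : MinorsPos X r) {I : Fin r → κ} (hI : StrictMono I) {J : Fin r → ι}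
    (hJ : StrictMono J) : 0 < (X.submatrix I J).det :=
  hX (OrderEmbedding.ofStrictMono I hI) (OrderEmbedding.ofStrictMono J hJ)

theorem exists_gap_of_not_consecutive {r : ℕ} {I : Fin (r + 1) → ℕ} (hI : StrictMono I)
    (h : ¬ ∀ a, I a = I 0 + a) : ∃ a : Fin r, I a.castSucc + 1 < I a.succ := by
  by_contra! hle
  refine h fun a => ?_
  induction a using Fin.induction with
  | zero => simp
  | succ a ih =>
    have h1 := hle a
    have h2 : I a.castSucc < I a.succ := hI (Fin.castSucc_lt_succ)
    simp only [Fin.val_castSucc, Fin.val_succ] at *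
    omega

/-- Fekete's criterion, one order at a time: if all minors of order `r` are positive and those
minors of order `r + 1` whose rows are consecutive belong to a convex cone, then so do all minors
of order `r + 1`. -/
theorem fekete {ι : Type*} [LinearOrder ι] {r : ℕ} (X : Matrix ℕ ι ℝ) (C : ℝ → Prop)
    (hadd : ∀ x y, C x → C y → C (x + y)) (hmul : ∀ x y, 0 < x → C y → C (x * y))
    (hpos : MinorsPos X r)
    (hcons : ∀ (i : ℕ) (J : Fin (r + 1) ↪o ι),
      C (X.submatrix (fun a : Fin (r + 1) => i + (a : ℕ)) J).det)
    (I : Fin (r + 1) ↪o ℕ) (J : Fin (r + 1) ↪o ι) : C (X.submatrix I J).det := by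
  -- Induction on the spread between the first and the last row.
  suffices h : ∀ (d : ℕ) (I : Fin (r + 1) → ℕ), StrictMono I → I (Fin.last r) - I 0 = d →
      C (X.submatrix I J).det from h _ I I.strictMono rfl
  intro d
  induction d using Nat.strong_induction_on with
  | _ d ih =>
  intro I hI hd
  by_cases hI' : ∀ a, I a = I 0 + a
  · have := hcons (I 0) J
    rwa [← funext hI'] at this
  obtain ⟨a, ha⟩ := exists_gap_of_not_consecutive hI hI'
  cases r with
  | zero => exact a.elim0
  | succ r =>
  -- A row is inserted into a gap. Deleting it recovers `I`; deleting an end row instead reduces the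
  -- spread, and the three-term relation links these minors with positive coefficients.
  set R := Fin.insertNth (α := fun _ => ℕ) a.castSucc.succ (I a.castSucc + 1) I with hR
  have hRm : StrictMono R := Fin.strictMono_insertNth hI a _ (Nat.lt_succ_self _) ha
  have hRI : R ∘ a.castSucc.succ.succAbove = I := by
    funext i
    simp [R]
  have hR0 : R 0 = I 0 := by
    rw [← hRI]; simp
  have hRl : R (Fin.last _) = I (Fin.last _) := by
    rw [← hRI]; simp
  have key := three_term_minors (X.submatrix R J) a
  simp only [Matrix.submatrix_submatrix, Function.comp_id] at key
  rw [hRI] at key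
  have hI0l : I 0 ≤ I (Fin.last _) := hI.monotone (Fin.zero_le _)
  have h0 : C (X.submatrix (R ∘ Fin.succAbove 0) J).det := by
    refine ih _ ?_ _ (hRm.comp (Fin.strictMono_succAbove _)) rfl
    have h1 : R 0 < R 1 := hRm (by simp)
    have h2 : R 1 ≤ R (Fin.last _) := hRm.monotone (Fin.le_last _)
    rw [Fin.succAbove_zero]
    change R (Fin.last (r + 2)) - R 1 < d
    omega
  have hl : C (X.submatrix (R ∘ (Fin.last _).succAbove) J).det := by
    refine ih _ ?_ _ (hRm.comp (Fin.strictMono_succAbove _)) rfl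
    have h1 : R (Fin.last (r + 1)).castSucc < R (Fin.last _) :=
      hRm (Fin.castSucc_lt_last _)
    have h2 : R 0 ≤ R (Fin.last (r + 1)).castSucc := hRm.monotone (Fin.zero_le _)
    simp only [Function.comp, Fin.succAbove_last, Fin.castSucc_zero]
    omega
  have hJs : StrictMono (J ∘ Fin.succ) := J.strictMono.comp (Fin.strictMono_succ)
  have e1 := hpos.of_strictMono (hRm.comp ((Fin.strictMono_succ).comp Fin.strictMono_castSucc)) hJs
  have e2 := hpos.of_strictMono
    (hRm.comp ((Fin.strictMono_castSucc).comp (Fin.strictMono_succAbove a.succ))) hJs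
  have e3 := hpos.of_strictMono
    (hRm.comp ((Fin.strictMono_succ).comp (Fin.strictMono_succAbove a.castSucc))) hJs
  have := hmul _ _ (inv_pos.2 e1) (hadd _ _ (hmul _ _ e2 h0) (hmul _ _ e3 hl))
  convert this using 1
  rw [eq_inv_mul_iff_mul_eq₀ e1.ne', mul_comm]
  refine key.trans ?_
  rw [mul_comm, add_comm, mul_comm, add_comm]
  rfl

/-- The matrix with the Gaussian entries `exp (-s (i - j) ^ 2)`. -/
noncomputable def gaussianMatrix (n : ℕ) (s : ℝ) : Matrix ℕ (Fin n) ℝ :=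
  Matrix.of fun i j => Real.exp (-s * ((i : ℝ) - (j : ℕ)) ^ 2)

/-- Expanding the square leaves, up to positive row and column factors, `exp (2 s i j)`. On
consecutive rows this is a Vandermonde matrix with increasing nodes, and Fekete's criterion does the
rest. -/
theorem minorsPos_gaussianMatrix {n : ℕ} {s : ℝ} (hs : 0 < s) (r : ℕ) :
    MinorsPos (gaussianMatrix n s) r := by
  induction r with
  | zero => intro I J; simp
  | succ r ih =>
    refine fekete _ (fun x => 0 < x) (fun _ _ => add_pos) (fun _ _ => mul_pos) ih fun i J => ?_
    have hV : 0 < (Matrix.vandermonde fun b : Fin (r + 1) =>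
        Real.exp (2 * s * ((J b : Fin n) : ℕ))).det := by
      rw [Matrix.det_vandermonde]
      refine Finset.prod_pos fun a _ => Finset.prod_pos fun b hb => sub_pos.2 ?_
      refine Real.exp_lt_exp.2 (mul_lt_mul_of_pos_left ?_ (by positivity))
      exact_mod_cast J.strictMono (Finset.mem_Ioi.1 hb)
    have hfac : (gaussianMatrix n s).submatrix (fun a : Fin (r + 1) => i + (a : ℕ)) J =
        Matrix.of fun a b : Fin (r + 1) => Real.exp (-s * ((i : ℝ) + (a : ℕ)) ^ 2) *
          (Matrix.of fun a b : Fin (r + 1) => Real.exp (-s * ((J b : Fin n) : ℕ) ^ 2 +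
            2 * s * i * ((J b : Fin n) : ℕ)) * (Matrix.vandermonde fun b : Fin (r + 1) =>
              Real.exp (2 * s * ((J b : Fin n) : ℕ))).transpose a b) a b := by
      ext a b
      simp only [gaussianMatrix, Matrix.submatrix_apply, Matrix.of_apply, Matrix.transpose_apply,
        Matrix.vandermonde_apply, ← Real.exp_nat_mul, ← Real.exp_add]
      congr 1
      push_cast
      ring
    rw [hfac, Matrix.det_mul_column, Matrix.det_mul_row, Matrix.det_transpose]
    exact mul_pos (Finset.prod_pos fun _ _ => Real.exp_pos _)
      (mul_pos (Finset.prod_pos fun _ _ => Real.exp_pos _) hV)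

theorem tendsto_gaussianMatrix {n : ℕ} (i j : Fin n) :
    Filter.Tendsto (fun s => gaussianMatrix n s i j) Filter.atTop
      (nhds ((1 : Matrix (Fin n) (Fin n) ℝ) i j)) := by
  by_cases h : i = j
  · subst h
    simp [gaussianMatrix]
  · rw [Matrix.one_apply_ne h]
    have hne : ((i : ℕ) : ℝ) - (j : ℕ) ≠ 0 := sub_ne_zero.2 (by exact_mod_cast Fin.val_ne_of_ne h)
    have hpos : 0 < (((i : ℕ) : ℝ) - (j : ℕ)) ^ 2 := by positivity
    refine Real.tendsto_exp_atBot.comp ?_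
    simp only [neg_mul]
    exact Filter.tendsto_neg_atTop_atBot.comp (Filter.tendsto_id.atTop_mul_const hpos)

/-! ### Minors under limits, products and rank conditions -/

open Matrix Filter Topology in
theorem MinorsNonneg.of_tendsto {κ ι α : Type*} [LinearOrder κ] [LinearOrder ι] {l : Filter α}
    [l.NeBot] {r : ℕ} {X : α → Matrix κ ι ℝ} {Y : Matrix κ ι ℝ}
    (hX : ∀ᶠ a in l, MinorsNonneg (X a) r) (h : ∀ i j, Tendsto (fun a => X a i j) l (𝓝 (Y i j))) :
    MinorsNonneg Y r := by
  intro I J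
  have hlim : Tendsto (fun a => (X a).submatrix I J) l (𝓝 (Y.submatrix I J)) :=
    tendsto_pi_nhds.2 fun i => tendsto_pi_nhds.2 fun j => h (I i) (J j)
  exact ge_of_tendsto (((continuous_id.matrix_det).tendsto _).comp hlim)
    (hX.mono fun a ha => ha I J)

theorem MinorsPos.minorsNonneg {κ ι : Type*} [LinearOrder κ] [LinearOrder ι] {X : Matrix κ ι ℝ}
    {r : ℕ} (hX : MinorsPos X r) : MinorsNonneg X r := fun I J => (hX I J).le

theorem MinorsNonneg.mul {κ ι : Type*} [LinearOrder κ] [LinearOrder ι] {n r : ℕ}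
    {X : Matrix κ (Fin n) ℝ} {Y : Matrix (Fin n) ι ℝ} (hX : MinorsNonneg X r)
    (hY : MinorsNonneg Y r) : MinorsNonneg (X * Y) r := by
  classical
  intro I J
  rw [Matrix.submatrix_mul X Y I id J Function.bijective_id, det_mul_eq_sum_minors]
  exact Finset.sum_nonneg fun L _ => mul_nonneg (hX I L) (hY L J)

theorem minorsNonneg_one (n r : ℕ) : MinorsNonneg (1 : Matrix (Fin n) (Fin n) ℝ) r := by
  -- The identity is a limit of totally positive Gaussian matrices.
  refine MinorsNonneg.of_tendsto (l := Filter.atTop)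
    (X := fun s => (gaussianMatrix n s).submatrix (fun i : Fin n => (i : ℕ)) id) ?_
    fun i j => tendsto_gaussianMatrix i j
  filter_upwards [Filter.eventually_gt_atTop 0] with s hs
  exact (minorsPos_gaussianMatrix hs r).minorsNonneg.submatrix Fin.val_strictMono strictMono_id

theorem MinorsNonneg.pow {n r : ℕ} {B : Matrix (Fin n) (Fin n) ℝ} (hB : MinorsNonneg B r)
    (i : ℕ) : MinorsNonneg (B ^ i) r := by
  induction i with
  | zero => rw [pow_zero]; exact minorsNonneg_one n r
  | succ i ih => rw [pow_succ]; exact ih.mul hB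

theorem isUnit_det_of_rank_eq {n : ℕ} {B : Matrix (Fin n) (Fin n) ℝ} (h : B.rank = n) :
    IsUnit B.det := by
  rw [← Matrix.isUnit_iff_isUnit_det, ← Matrix.mulVec_surjective_iff_isUnit]
  have : LinearMap.range B.mulVecLin = ⊤ := by
    apply Submodule.eq_top_of_finrank_eq
    rw [Module.finrank_fin_fun]
    exact h
  exact LinearMap.range_eq_top.1 this

/-- By Cauchy–Binet the Gram determinant of the rows would vanish if every maximal minor did,
although `X * Xᵀ` has the rank of `X`. -/
theorem exists_minor_ne_zero {r n : ℕ} {X : Matrix (Fin r) (Fin n) ℝ} (h : X.rank = r) :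
    ∃ J : Fin r ↪o Fin n, (X.submatrix id J).det ≠ 0 := by
  classical
  by_contra! h0
  have hdet := (isUnit_det_of_rank_eq ((Matrix.rank_self_mul_transpose X).trans h)).ne_zero
  refine hdet ?_
  rw [det_mul_eq_sum_minors]
  exact Finset.sum_eq_zero fun J _ => by rw [h0 J, zero_mul]

theorem det_mul_pos_of_minorsPos {ι : Type*} [LinearOrder ι] {r n : ℕ}
    {X : Matrix (Fin r) (Fin n) ℝ} {G : Matrix (Fin n) ι ℝ} (hX : MinorsNonneg X r)
    (hrank : X.rank = r) (hG : MinorsPos G r) (J : Fin r ↪o ι) :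
    0 < (X * G.submatrix id J).det := by
  classical
  obtain ⟨L, hL⟩ := exists_minor_ne_zero hrank
  rw [det_mul_eq_sum_minors]
  refine Finset.sum_pos' (fun L _ => mul_nonneg (hX (RelEmbedding.refl _) L) (hG L J).le)
    ⟨L, Finset.mem_univ _, mul_pos (lt_of_le_of_ne (hX (RelEmbedding.refl _) L) hL.symm) (hG L J)⟩

/-! ### Minors of the observability matrix -/

open Matrix in
/-- The infinite observability matrix with rows `c A ^ t`. -/
def observabilityRows {n : ℕ} (A : Matrix (Fin n) (Fin n) ℝ) (c : Fin n → ℝ) :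
    Matrix ℕ (Fin n) ℝ :=
  Matrix.of fun t => c ᵥ* A ^ t

open Matrix in
theorem observabilityMatrix_eq_submatrix {n : ℕ} (A : Matrix (Fin n) (Fin n) ℝ) (c : Fin n → ℝ)
    (j : ℕ) : observabilityMatrix A c j = (observabilityRows A c).submatrix Fin.val id := by
  ext t i
  simp [observabilityMatrix, controllabilityMatrix, observabilityRows, ← Matrix.transpose_pow,
    Matrix.mulVec_transpose]

open Matrix in
theorem observabilityRows_submatrix_add {n : ℕ} (A : Matrix (Fin n) (Fin n) ℝ) (c : Fin n → ℝ)
    (i r : ℕ) : (observabilityRows A c).submatrix (fun a : Fin r => i + (a : ℕ)) id =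
      observabilityMatrix A c r * A ^ i := by
  rw [observabilityMatrix_eq_submatrix]
  ext a j
  change (c ᵥ* A ^ (i + (a : ℕ))) j = ((c ᵥ* A ^ (a : ℕ)) ᵥ* A ^ i) j
  rw [Matrix.vecMul_vecMul, ← pow_add, add_comm]

/-- All minors of order at most `k` of the observability matrix of an invertible system matrix
are nonnegative, provided that its leading blocks are nonnegative and of full rank. -/
theorem minorsNonneg_observabilityRows_of_isUnit {n k : ℕ} {B : Matrix (Fin n) (Fin n) ℝ}
    {c : Fin n → ℝ} (hB : ∀ r ≤ k, MinorsNonneg B r) (hdet : IsUnit B.det)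
    (hO : ∀ r ≤ k, MinorsNonneg (observabilityMatrix B c r) r)
    (hrank : ∀ r < k, (observabilityMatrix B c r).rank = r) {r : ℕ} (hr : r ≤ k) :
    MinorsNonneg (observabilityRows B c) r := by
  set G : ℝ → Matrix (Fin n) (Fin n) ℝ :=
    fun s => (gaussianMatrix n s).submatrix (fun i : Fin n => (i : ℕ)) id with hGdef
  have hG : ∀ s > 0, ∀ r, MinorsPos (G s) r := fun s hs r I J =>
    (minorsPos_gaussianMatrix hs r).of_strictMono (Fin.val_strictMono.comp I.strictMono)
      J.strictMono
  have hcons : ∀ s, ∀ (r i : ℕ) (J : Fin r ↪o Fin n),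
      (observabilityRows B c * G s).submatrix (fun a : Fin r => i + (a : ℕ)) J =
        observabilityMatrix B c r * B ^ i * (G s).submatrix id J := by
    intro s r i J
    rw [Matrix.submatrix_mul _ _ _ id _ Function.bijective_id, observabilityRows_submatrix_add]
  have hnn : ∀ r ≤ k, ∀ i, MinorsNonneg (observabilityMatrix B c r * B ^ i) r := fun r hr i =>
    (hO r hr).mul ((hB r hr).pow i)
  have hpos : ∀ s > 0, ∀ r < k, MinorsPos (observabilityRows B c * G s) r := by
    intro s hs r
    induction r with
    | zero => intro _ I J; simp
    | succ r ih =>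
      intro hr
      refine fekete _ (fun x => 0 < x) (fun _ _ => add_pos) (fun _ _ => mul_pos)
        (ih (by omega)) fun i J => ?_
      rw [hcons]
      refine det_mul_pos_of_minorsPos (hnn _ hr.le i) ?_ (hG s hs _) J
      -- Invertibility of `B` keeps the shifted block at full rank.
      rw [Matrix.rank_mul_eq_left_of_isUnit_det _ _ (by rw [Matrix.det_pow]; exact hdet.pow i)]
      exact hrank _ hr
  have hs : ∀ s > 0, MinorsNonneg (observabilityRows B c * G s) r := by
    intro s hs
    rcases hr.lt_or_eq with hlt | rfl
    -- At order `k` no rank is assumed, so Fekete's criterion is run with the cone of nonnegative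
    -- numbers.
    · exact (hpos s hs r hlt).minorsNonneg
    cases r with
    | zero => intro I J; simp
    | succ r =>
      refine fekete _ (fun x => 0 ≤ x) (fun _ _ => add_nonneg)
        (fun _ _ h => mul_nonneg h.le) (hpos s hs r (Nat.lt_succ_self r)) fun i J => ?_
      rw [hcons]
      exact (hnn _ le_rfl i).mul ((hG s hs _).minorsNonneg.submatrix strictMono_id J.strictMono)
        (RelEmbedding.refl _) (RelEmbedding.refl _)
  refine MinorsNonneg.of_tendsto (l := Filter.atTop) (X := fun s => observabilityRows B c * G s)
    ?_ fun i j => ?_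
  · filter_upwards [Filter.eventually_gt_atTop 0] with s hs'
    exact hs s hs'
  · have : observabilityRows B c i j = (observabilityRows B c *
        (1 : Matrix (Fin n) (Fin n) ℝ)) i j := by rw [Matrix.mul_one]
    rw [this]
    simp only [Matrix.mul_apply]
    exact tendsto_finsetSum _ fun l _ => (tendsto_gaussianMatrix l j).const_mul _

open Matrix in
theorem observabilityMatrix_add_smul_one {n : ℕ} (A : Matrix (Fin n) (Fin n) ℝ) (c : Fin n → ℝ)
    (η : ℝ) (r : ℕ) : ∃ L : Matrix (Fin r) (Fin r) ℝ, L.det = 1 ∧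
      observabilityMatrix (A + η • (1 : Matrix (Fin n) (Fin n) ℝ)) c r =
        L * observabilityMatrix A c r := by
  -- Binomial coefficients of `(A + η I) ^ i`; the truncated exponent for `l > i` is harmless
  -- because the coefficient vanishes there.
  refine ⟨Matrix.of fun i l => ((i : ℕ).choose l : ℝ) * η ^ ((i : ℕ) - l), ?_, ?_⟩
  · rw [Matrix.det_of_isLowerTriangular]
    · simp
    · intro i l h
      have : (i : ℕ) < l := by simpa using h
      simp [Nat.choose_eq_zero_of_lt this]
  · rw [observabilityMatrix_eq_submatrix, observabilityMatrix_eq_submatrix]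
    ext i j
    have hpow : (A + η • (1 : Matrix (Fin n) (Fin n) ℝ)) ^ (i : ℕ) =
        ∑ m ∈ Finset.range r, (((i : ℕ).choose m : ℝ) * η ^ ((i : ℕ) - m)) • A ^ m := by
      rw [((Commute.one_right A).smul_right η).add_pow]
      refine (Finset.sum_congr rfl fun m _ => ?_).trans
        (Finset.sum_subset (Finset.range_subset_range.2 i.2) fun m _ hm => ?_)
      · rw [smul_pow, one_pow, mul_smul_comm, mul_one, ← nsmul_eq_mul', mul_smul,
          Nat.cast_smul_eq_nsmul]
      · rw [Nat.choose_eq_zero_of_lt (by simpa using hm)]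
        simp
    change (c ᵥ* (A + η • (1 : Matrix (Fin n) (Fin n) ℝ)) ^ (i : ℕ)) j = _
    rw [hpow, Matrix.mul_apply, Matrix.vecMul_sum, Finset.sum_apply, ← Fin.sum_univ_eq_sum_range
      (fun m => (c ᵥ* ((((i : ℕ).choose m : ℝ) * η ^ ((i : ℕ) - m)) • A ^ m)) j)]
    refine Finset.sum_congr rfl fun l _ => ?_
    rw [Matrix.vecMul_smul]
    rfl

theorem minorsNonneg_observabilityRows {n k : ℕ} {A : Matrix (Fin n) (Fin n) ℝ} {c : Fin n → ℝ}
    (hO : ∀ r ≤ k, MinorsNonneg (observabilityMatrix A c r) r)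
    (hrank : ∀ r < k, (observabilityMatrix A c r).rank = r) {ε : ℝ} (hε : 0 < ε)
    (hA : ∀ η ∈ Set.Ioo (0 : ℝ) ε,
      (∀ r ≤ k, MinorsNonneg (A + η • (1 : Matrix (Fin n) (Fin n) ℝ)) r) ∧
      IsUnit (A + η • (1 : Matrix (Fin n) (Fin n) ℝ)).det) {r : ℕ} (hr : r ≤ k) :
    MinorsNonneg (observabilityRows A c) r := by
  refine MinorsNonneg.of_tendsto (l := nhdsWithin 0 (Set.Ioi 0))
    (X := fun η : ℝ => observabilityRows (A + η • (1 : Matrix (Fin n) (Fin n) ℝ)) c)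
    ?_ fun t j => ?_
  · filter_upwards [Ioo_mem_nhdsGT hε] with η hη
    obtain ⟨hB, hdet⟩ := hA η hη
    refine minorsNonneg_observabilityRows_of_isUnit hB hdet (fun r hr I J => ?_)
      (fun r hr => ?_) hr
    · obtain ⟨L, hL, hLO⟩ := observabilityMatrix_add_smul_one A c η r
      -- The only increasing self-map of `Fin r` is the identity.
      have hI : I = RelEmbedding.refl _ := DFunLike.coe_injective <|
        (I.strictMono.range_inj strictMono_id).1 <| by
          rw [(Finite.surjective_of_injective I.injective).range_eq]
          exact Set.range_id.symm
      have hid : (L * observabilityMatrix A c r).submatrix id J =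
          L * (observabilityMatrix A c r).submatrix id J := rfl
      rw [hI, hLO]
      change 0 ≤ ((L * observabilityMatrix A c r).submatrix id J).det
      rw [hid, Matrix.det_mul, hL, one_mul]
      exact hO r hr (RelEmbedding.refl _) J
    · obtain ⟨L, hL, hLO⟩ := observabilityMatrix_add_smul_one A c η r
      rw [hLO, Matrix.rank_mul_eq_right_of_isUnit_det _ _ (by rw [hL]; exact isUnit_one)]
      exact hrank r hr
  · have hcont : Continuous fun η : ℝ =>
        observabilityRows (A + η • (1 : Matrix (Fin n) (Fin n) ℝ)) c t j := by
      unfold observabilityRows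
      simp only [Matrix.of_apply, Matrix.vecMul, dotProduct]
      refine continuous_finsetSum _ fun i _ => continuous_const.mul ?_
      have : Continuous fun η : ℝ => (A + η • (1 : Matrix (Fin n) (Fin n) ℝ)) ^ t := by fun_prop
      exact this.matrix_elem i j
    have := hcont.tendsto 0
    simp only [zero_smul, add_zero] at this
    exact this.mono_left nhdsWithin_le_nhds

/-! ### The corollary -/

theorem mainTheorem11 (n k : ℕ) (hk : 1 ≤ k)
    (A : Matrix (Fin n) (Fin n) ℝ) (c : Fin n → ℝ)
    (hO : ∀ j, 1 ≤ j → j ≤ k →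
      EntrywiseNonneg (compoundMatrix (observabilityMatrix A c j) j))
    (hrank : ∀ j, 1 ≤ j → j ≤ k - 1 → (observabilityMatrix A c j).rank = j)
    (hA : ∃ ε : ℝ, 0 < ε ∧ ∀ η ∈ Set.Ioo (0 : ℝ) ε,
      IsKPositive k (A + η • (1 : Matrix (Fin n) (Fin n) ℝ)) ∧
      (A + η • (1 : Matrix (Fin n) (Fin n) ℝ)).rank = n) :
    IsOVD (k - 1) (observabilityOperator A c) ∧
    ∀ t : ℕ, IsOVD (k - 1) (observabilityMatrix A c t).mulVecLin := by
  obtain ⟨ε, hε, hA⟩ := hA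
  have hX : ∀ r ≤ k - 1 + 1, MinorsNonneg (observabilityRows A c) r := fun r hr => by
    refine minorsNonneg_observabilityRows (k := k) (fun j hj => ?_) (fun j hj => ?_) hε
      (fun η hη => ⟨fun j hj => ?_, isUnit_det_of_rank_eq (hA η hη).2⟩) (by omega)
    -- Order zero, absent from the hypotheses, is trivial: the empty minor is `1` and the empty
    -- matrix has rank `0`.
    · rcases Nat.eq_zero_or_pos j with rfl | h
      · intro I J; simp
      · exact hO j h hj
    · rcases Nat.eq_zero_or_pos j with rfl | h
      · exact Nat.le_zero.1 (Matrix.rank_le_height _)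
      · exact hrank j h (by omega)
    · rcases Nat.eq_zero_or_pos j with rfl | h
      · intro I J; simp
      · exact (hA η hη).1.2 j h hj
  refine ⟨isOVD_of_minorsNonneg _ _ hX _ fun u => ?_, fun t =>
    isOVD_of_minorsNonneg _ _ (fun r hr => ?_) _ fun u => rfl⟩
  · funext t
    exact Matrix.dotProduct_mulVec c (A ^ t) u
  · rw [observabilityMatrix_eq_submatrix]
    exact (hX r hr).submatrix Fin.val_strictMono strictMono_id
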